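/- All digraphs are finite and loopless, and may have parallel arcs as well as arcs in opposite directions between two vertices. A digraph is strongly connected if it has at least one vertex and, for all vertices $u,v$, a directed path from $u$ to $v$. A digraph is semicomplete if any two distinct vertices $u,v$ are joined by at least one arc, from $u$ to $v$ or from $v$ to $u$. A digraph $G$ contains a digraph $H$ as an immersion if the vertices of $H$ can be mapped to distinct vertices of $G$, and the arcs of $H$ to pairwise arc-disjoint directed paths of $G$ (which may share vertices), so that an arc from $x$ to $y$ is mapped to a path from the image of $x$ to the image of $y$. Theorem. For every strongly connected digraph $H$ on at least two vertices there is a function $f\colon\mathbb{N}\to\mathbb{N}$ such that, for every semicomplete digraph $G$ and every positive integer $k$, one of the following holds: - $G$ has $k$ pairwise arc-disjoint subdigraphs, each containing $H$ as an immersion; or - there is a set $X\subseteq E(G)$ of arcs with $|X|\le f(k)$ such that $G\setminus X$ does not contain $H$ as an immersion. -/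

import Mathlib

/-- A directed multigraph with vertex type `V` and arc type `A`: parallel arcs (and arcs in opposite
directions) are allowed, loops are not. -/
structure MultiDigraph (V A : Type*) where
  /-- the tail of an arc -/
  src : A → V
  /-- the head of an arc -/
  tgt : A → V
  loopless : ∀ a, src a ≠ tgt a

namespace MultiDigraph

/-- `G.IsWalk u l v`: the list of arcs `l` is a directed walk of `G` from `u` to `v`. -/
def IsWalk {V A : Type*} (G : MultiDigraph V A) : V → List A → V → Prop
  | u, [], v => u = v
  | u, a :: l, v => G.src a = u ∧ G.IsWalk (G.tgt a) l v

/-- `G.IsPath u l v`: the list of arcs `l` is a directed path of `G` from `u` to `v`, that is, a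
directed walk that visits no vertex twice (`u` followed by the heads of the arcs is the sequence of
visited vertices). -/
def IsPath {V A : Type*} (G : MultiDigraph V A) (u : V) (l : List A) (v : V) : Prop :=
  G.IsWalk u l v ∧ (u :: l.map G.tgt).Nodup

/-- A digraph is strongly connected if it has a vertex and, for all vertices `u`, `v`, a directed
path from `u` to `v`. -/
def StronglyConnected {V A : Type*} (G : MultiDigraph V A) : Prop :=
  Nonempty V ∧ ∀ u v : V, ∃ l : List A, G.IsPath u l v

/-- A digraph is semicomplete if any two distinct vertices are joined by an arc, in at least one of
the two directions. -/
def Semicomplete {V A : Type*} (G : MultiDigraph V A) : Prop :=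
  ∀ u v : V, u ≠ v → ∃ a : A, (G.src a = u ∧ G.tgt a = v) ∨ (G.src a = v ∧ G.tgt a = u)

/-- `G` contains `H` as an immersion: the vertices of `H` can be mapped to distinct vertices of `G`,
and the arcs of `H` to directed paths of `G` between the corresponding vertices, such that no two of
these paths share an arc (they may share vertices). -/
def ContainsImmersion {V A W B : Type*} (G : MultiDigraph V A) (H : MultiDigraph W B) : Prop :=
  ∃ (φ : W → V) (P : B → List A),
    Function.Injective φ ∧
    (∀ e : B, G.IsPath (φ (H.src e)) (P e) (φ (H.tgt e))) ∧
    ∀ e e' : B, e ≠ e' → List.Disjoint (P e) (P e')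

/-- A subdigraph of `G`: a set of vertices and a set of arcs with both ends in it. -/
structure Subdigraph {V A : Type*} (G : MultiDigraph V A) where
  verts : Set V
  arcs : Set A
  src_mem : ∀ a ∈ arcs, G.src a ∈ verts
  tgt_mem : ∀ a ∈ arcs, G.tgt a ∈ verts

/-- A subdigraph as a digraph in its own right. -/
def Subdigraph.toMultiDigraph {V A : Type*} {G : MultiDigraph V A} (K : G.Subdigraph) :
    MultiDigraph K.verts K.arcs where
  src a := ⟨G.src a, K.src_mem a a.2⟩
  tgt a := ⟨G.tgt a, K.tgt_mem a a.2⟩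
  loopless a h := G.loopless a (congrArg Subtype.val h)

/-- The digraph obtained from `G` by deleting the arcs in `X`. -/
def deleteArcs {V A : Type*} (G : MultiDigraph V A) (X : Set A) :
    MultiDigraph V {a : A // a ∉ X} where
  src a := G.src a
  tgt a := G.tgt a
  loopless a := G.loopless a

end MultiDigraph

/-!
# The Erdős–Pósa property of immersions in semicomplete digraphs

Fix a strongly connected digraph `H` with at least one arc, and let `G` be a semicomplete digraph,
possibly with parallel arcs, without `k` arc-disjoint copies of `H`. The proof is by induction on
`k`. Write `M = k * #B`, where `B` is the set of arcs of `H`.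

*Small cuts with `H` on both sides.* If few arcs leave a set `S` and `H` is immersed both inside `S`
and outside `S`, then neither side has `k - 1` copies, and the induction hypothesis provides small
hitting sets on both sides. Together with the arcs leaving `S` they hit every copy, because a
strongly connected digraph avoiding these arcs lies on one side (`ImmersesIn.inside_or_inside`).

*Highly connected vertices.* If many vertices are pairwise not separated by small cuts, then by
`exists_transitive` they include a large transitive tournament, and by Menger's theorem
(`exists_disjoint_walks`) there are `M` arc-disjoint walks from its last vertex to its first one,
avoiding the arcs of the tournament. This structure contains any `k` copies of `H`
(`packs_of_transitive`). Menger's theorem is proved by splitting off arcs.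

*Small cuts with a side without `H`.* Otherwise every small cut has a side without `H`, and all but
boundedly many vertices lie in the `H`-free side of some small cut. In a semicomplete digraph small
cuts are nearly nested, so a single largest `H`-free set `L` with few leaving arcs contains all but
boundedly many of the vertices in such sets (`exists_mem_card_biUnion_sdiff_le`); the same applied to
the reversed digraph gives a set `R` with few entering arcs. Deleting these two cuts confines `H` to a
bounded set `P` of remaining vertices. Inside `P`, delete all arcs with at most `M` parallel copies.
If `H` survives, each arc that it uses can be replaced by more than `M` parallel ones, which gives `k`
copies (`packs_of_parallel`).
-/

namespace MultiDigraph

open Finset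

/-! ### Walks and paths -/

section Walks

variable {V A : Type*} {G : MultiDigraph V A}

theorem IsWalk.append {u v w : V} {l l' : List A} (h : G.IsWalk u l v) (h' : G.IsWalk v l' w) :
    G.IsWalk u (l ++ l') w := by
  induction l generalizing u with
  | nil => cases h; exact h'
  | cons a l ih => exact ⟨h.1, ih h.2⟩

theorem isWalk_singleton {u v : V} {a : A} (hs : G.src a = u) (ht : G.tgt a = v) :
    G.IsWalk u [a] v := ⟨hs, ht⟩

/-- A tail of a path, cut off at one of the visited vertices, is a path. -/
theorem IsPath.exists_suffix {x v u : V} {l : List A} (h : G.IsPath x l v)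
    (hu : u ∈ x :: l.map G.tgt) : ∃ l', l' <:+ l ∧ G.IsPath u l' v := by
  induction l generalizing x with
  | nil =>
    obtain rfl : u = x := by simpa using hu
    exact ⟨[], List.suffix_rfl, h⟩
  | cons a l ih =>
    rcases List.mem_cons.1 hu with rfl | hu
    · exact ⟨a :: l, List.suffix_rfl, h⟩
    · obtain ⟨l', hl', hp⟩ := ih (x := G.tgt a) ⟨h.1.2, (List.nodup_cons.1 h.2).2⟩ hu
      exact ⟨l', hl'.trans (List.suffix_cons a l), hp⟩

theorem IsWalk.exists_isPath {u v : V} {l : List A} (h : G.IsWalk u l v) :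
    ∃ l', l' ⊆ l ∧ G.IsPath u l' v := by
  induction l generalizing u with
  | nil => exact ⟨[], List.Subset.refl _, h, by simp⟩
  | cons a l ih =>
    obtain ⟨l', hl', hp⟩ := ih h.2
    by_cases hu : u ∈ G.tgt a :: l'.map G.tgt
    · obtain ⟨l'', hs, hp'⟩ := hp.exists_suffix hu
      exact ⟨l'', fun x hx => List.mem_cons_of_mem _ (hl' (hs.subset hx)), hp'⟩
    · refine ⟨a :: l', List.cons_subset_cons a hl', ⟨h.1, hp.1⟩, ?_⟩
      rw [List.map_cons, List.nodup_cons]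
      exact ⟨hu, hp.2⟩

/-- If no arc of a walk leaves `S` and the walk starts in `S`, all its arcs lie inside `S`. -/
theorem IsWalk.mem_of_start_mem {S : Set V} {u v : V} {l : List A} (h : G.IsWalk u l v)
    (hl : ∀ a ∈ l, G.src a ∈ S → G.tgt a ∈ S) (hu : u ∈ S) :
    v ∈ S ∧ ∀ a ∈ l, G.src a ∈ S ∧ G.tgt a ∈ S := by
  induction l generalizing u with
  | nil => cases h; simpa using hu
  | cons a l ih =>
    obtain ⟨rfl, h⟩ := h
    have ha := hl a (by simp) hu
    obtain ⟨hv, hr⟩ := ih h (fun b hb => hl b (by simp [hb])) ha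
    refine ⟨hv, fun b hb => ?_⟩
    rcases List.mem_cons.1 hb with rfl | hb
    · exact ⟨hu, ha⟩
    · exact hr b hb

/-- If no arc of a walk leaves `S` and the walk ends outside `S`, all its arcs lie outside `S`. -/
theorem IsWalk.notMem_of_end_notMem {S : Set V} {u v : V} {l : List A} (h : G.IsWalk u l v)
    (hl : ∀ a ∈ l, G.src a ∈ S → G.tgt a ∈ S) (hv : v ∉ S) :
    u ∉ S ∧ ∀ a ∈ l, G.src a ∉ S ∧ G.tgt a ∉ S := by
  induction l generalizing u with
  | nil => cases h; simpa using hv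
  | cons a l ih =>
    obtain ⟨rfl, h⟩ := h
    obtain ⟨ht, hr⟩ := ih h (fun b hb => hl b (by simp [hb]))
    have hs : G.src a ∉ S := fun hs => ht (hl a (by simp) hs)
    refine ⟨hs, fun b hb => ?_⟩
    rcases List.mem_cons.1 hb with rfl | hb
    · exact ⟨hs, ht⟩
    · exact hr b hb

/-- Replacing every arc of a path by a parallel one gives a path. -/
theorem IsPath.map_parallel {u v : V} {l : List A} (h : G.IsPath u l v) (g : A → A)
    (hg : ∀ a ∈ l, G.src (g a) = G.src a ∧ G.tgt (g a) = G.tgt a) :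
    G.IsPath u (l.map g) v := by
  refine ⟨?_, ?_⟩
  · replace h := h.1
    induction l generalizing u with
    | nil => exact h
    | cons a l ih =>
      refine ⟨(hg a (by simp)).1.trans h.1, ih (fun b hb => hg b (by simp [hb])) ?_⟩
      rw [(hg a (by simp)).2]
      exact h.2
  · have : (l.map g).map G.tgt = l.map G.tgt := by
      rw [List.map_map]
      exact List.map_congr_left fun a ha => (hg a ha).2
    rw [this]
    exact h.2

end Walks

/-! ### Cuts and Menger's theorem for arcs -/

section Cuts

open Classical in
/-- The arcs of `F` from `S` to its complement. The tail and head maps are arguments, so that the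
definition also covers the reversed digraph and digraphs obtained by redirecting arcs. -/
noncomputable def outCut {V A : Type*} (src tgt : A → V) (F : Finset A) (S : Finset V) :
    Finset A :=
  F.filter fun a => src a ∈ S ∧ tgt a ∉ S

variable {V A : Type*}

theorem mem_outCut {src tgt : A → V} {F : Finset A} {S : Finset V} {a : A} :
    a ∈ outCut src tgt F S ↔ a ∈ F ∧ src a ∈ S ∧ tgt a ∉ S := by
  classical
  simp [outCut]

open Classical in
theorem card_outCut_inter_add_card_outCut_union (src tgt : A → V) (F : Finset A)
    (S T : Finset V) :
    #(outCut src tgt F (S ∩ T)) + #(outCut src tgt F (S ∪ T)) ≤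
      #(outCut src tgt F S) + #(outCut src tgt F T) := by
  simp only [outCut, card_filter, ← sum_add_distrib]
  refine sum_le_sum fun a _ => ?_
  by_cases h1 : src a ∈ S <;> by_cases h2 : src a ∈ T <;> by_cases h3 : tgt a ∈ S <;>
    by_cases h4 : tgt a ∈ T <;> simp [h1, h2, h3, h4]

/-- Menger's theorem for a digraph whose arcs stand for pairwise disjoint walks `w a` of `G`. In the
induction an arc `a` leaving `s` and an arc `b` starting at its head are split off: `a` now stands
for the concatenation of the two walks, and `b` disappears. -/
theorem exists_disjoint_walks_aux (G : MultiDigraph V A) {s t : V} (hst : s ≠ t) (m : ℕ)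
    (E : Set A) (F : Finset A) (src tgt : A → V) (w : A → List A)
    (hw : ∀ a ∈ F, G.IsWalk (src a) (w a) (tgt a)) (hE : ∀ a ∈ F, ∀ x ∈ w a, x ∈ E)
    (hd : ∀ a ∈ F, ∀ b ∈ F, a ≠ b → List.Disjoint (w a) (w b))
    (hcut : ∀ S : Finset V, s ∈ S → t ∉ S → m ≤ #(outCut src tgt F S)) :
    ∃ (D : Finset A) (q : A → List A), m ≤ #D ∧ (∀ a ∈ D, G.IsWalk s (q a) t) ∧
      (∀ a ∈ D, ∀ x ∈ q a, x ∈ E) ∧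
      ∀ a ∈ D, ∀ b ∈ D, a ≠ b → List.Disjoint (q a) (q b) := by
  classical
  induction hn : #F using Nat.strong_induction_on generalizing F src tgt w with
  | _ n ih =>
  by_cases hs : ∀ a ∈ F, src a = s → tgt a = t
  · refine ⟨outCut src tgt F {s}, w, hcut {s} (by simp) (by simpa using hst.symm), ?_, ?_, ?_⟩
    · intro a ha
      rw [mem_outCut, mem_singleton] at ha
      have := hw a ha.1
      rwa [ha.2.1, hs a ha.1 ha.2.1] at this
    · exact fun a ha => hE a (mem_outCut.1 ha).1
    · exact fun a ha b hb => hd a (mem_outCut.1 ha).1 b (mem_outCut.1 hb).1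
  push Not at hs
  obtain ⟨a, haF, has, hat⟩ := hs
  by_cases hdel : ∀ S : Finset V, s ∈ S → t ∉ S → m ≤ #(outCut src tgt (F.erase a) S)
  · exact ih _ (by rw [← hn]; exact card_erase_lt_of_mem haF) (F.erase a) src tgt w
      (fun b hb => hw b (mem_of_mem_erase hb)) (fun b hb => hE b (mem_of_mem_erase hb))
      (fun b hb c hc => hd b (mem_of_mem_erase hb) c (mem_of_mem_erase hc)) hdel rfl
  push Not at hdel
  obtain ⟨S₀, hsS₀, htS₀, hS₀⟩ := hdel
  -- the tight cuts that `a` crosses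
  let Tight : Finset V → Prop := fun S =>
    s ∈ S ∧ t ∉ S ∧ tgt a ∉ S ∧ #(outCut src tgt F S) = m
  have hT₀ : Tight S₀ := by
    have hle : #(outCut src tgt F S₀) ≤ #(outCut src tgt (F.erase a) S₀) + 1 := by
      have : outCut src tgt F S₀ ⊆ insert a (outCut src tgt (F.erase a) S₀) := by
        intro x hx
        rw [mem_insert, mem_outCut, mem_erase]
        rw [mem_outCut] at hx
        tauto
      exact (card_le_card this).trans (card_insert_le _ _)
    have hm := hcut S₀ hsS₀ htS₀
    refine ⟨hsS₀, htS₀, fun hmem => ?_, by omega⟩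
    have : outCut src tgt F S₀ ⊆ outCut src tgt (F.erase a) S₀ := by
      intro x hx
      rw [mem_outCut] at hx
      rw [mem_outCut, mem_erase]
      exact ⟨⟨fun h => hx.2.2 (h ▸ hmem), hx.1⟩, hx.2⟩
    have := card_le_card this
    omega
  -- `V` may be infinite, so the size of a tight set is measured by the heads of arcs it contains
  let heads : Finset V → ℕ := fun S => #(F.filter fun b => tgt b ∈ S)
  obtain ⟨S, hS, hmax⟩ : ∃ S, Tight S ∧ ∀ T, Tight T → heads T ≤ heads S := by
    have hfin : (heads '' {S | Tight S}).Finite :=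
      (Set.finite_le_nat #F).subset (by rintro _ ⟨S, -, rfl⟩; exact card_filter_le _ _)
    obtain ⟨x, ⟨S, hS, rfl⟩, hx⟩ :=
      hfin.exists_maximalFor id _ ⟨_, ⟨S₀, hT₀, rfl⟩⟩
    refine ⟨S, hS, fun T hT => ?_⟩
    by_contra hlt
    exact hlt (hx ⟨T, hT, rfl⟩ (le_of_not_ge hlt))
  obtain ⟨b, hbF, hbs, hbt⟩ : ∃ b ∈ F, src b = tgt a ∧ tgt b ∉ S := by
    by_contra hno
    push Not at hno
    have h1 := hcut (insert (tgt a) S) (mem_insert_of_mem hS.1)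
      (by simp [hS.2.1, hat.symm])
    have h2 : outCut src tgt F (insert (tgt a) S) ⊂ outCut src tgt F S := by
      refine (ssubset_iff_of_subset fun x hx => ?_).2 ⟨a, ?_, ?_⟩
      · rw [mem_outCut, mem_insert, mem_insert, not_or] at hx
        rw [mem_outCut]
        refine ⟨hx.1, hx.2.1.resolve_left fun h => hx.2.2.2 (hno x hx.1 h), hx.2.2.2⟩
      · rw [mem_outCut, has]
        exact ⟨haF, hS.1, hS.2.2.1⟩
      · rw [mem_outCut]
        simp
    have := card_lt_card h2
    have := hS.2.2.2
    omega
  have hab : a ≠ b := by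
    rintro rfl
    exact hS.2.2.1 (by rw [← hbs, has]; exact hS.1)
  refine ih _ (by rw [← hn]; exact card_erase_lt_of_mem hbF) (F.erase b) src
    (Function.update tgt a (tgt b)) (Function.update w a (w a ++ w b)) ?_ ?_ ?_ ?_ rfl
  · intro x hx
    rw [mem_erase] at hx
    rcases eq_or_ne x a with rfl | hxa
    · rw [Function.update_self, Function.update_self]
      refine (hw x haF).append ?_
      rw [← hbs]
      exact hw b hbF
    · rw [Function.update_of_ne hxa, Function.update_of_ne hxa]
      exact hw x hx.2
  · intro x hx y hy
    rw [mem_erase] at hx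
    rcases eq_or_ne x a with rfl | hxa
    · rw [Function.update_self, List.mem_append] at hy
      exact hy.elim (hE x haF y) (hE b hbF y)
    · rw [Function.update_of_ne hxa] at hy
      exact hE x hx.2 y hy
  · intro x hx y hy hxy
    rw [mem_erase] at hx hy
    rcases eq_or_ne x a with rfl | hxa
    · rw [Function.update_self, Function.update_of_ne hxy.symm, List.disjoint_append_left]
      exact ⟨hd _ haF _ hy.2 hxy, hd _ hbF _ hy.2 hy.1.symm⟩
    · rw [Function.update_of_ne hxa]
      rcases eq_or_ne y a with rfl | hya
      · rw [Function.update_self, List.disjoint_append_right]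
        exact ⟨hd _ hx.2 _ haF hxy, hd _ hx.2 _ hbF hx.1⟩
      · rw [Function.update_of_ne hya]
        exact hd _ hx.2 _ hy.2 hxy
  · intro T hsT htT
    have hm := hcut T hsT htT
    by_cases haT : tgt a ∈ T
    · -- `a` did not cross `T`, and it does now if `b` crossed `T`
      refine hm.trans (card_le_card_of_injOn (fun x => if x = b then a else x) ?_ ?_)
      · intro x hx
        rw [mem_coe, mem_outCut] at hx ⊢
        by_cases hxb : x = b
        · subst hxb
          simpa [haF, hab, has, hsT] using hx.2.2
        · have hxa : x ≠ a := fun h => hx.2.2 (h ▸ haT)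
          simp only [hxb, if_false, mem_erase, Function.update_of_ne hxa]
          exact ⟨⟨hxb, hx.1⟩, hx.2⟩
      · intro x hx y hy hxy
        rw [mem_coe, mem_outCut] at hx hy
        have hxa : x ≠ a := fun h => hx.2.2 (h ▸ haT)
        have hya : y ≠ a := fun h => hy.2.2 (h ▸ haT)
        simp only at hxy
        split_ifs at hxy with h1 h2 h2
        · rw [h1, h2]
        · exact absurd hxy.symm hya
        · exact absurd hxy hxa
        · exact hxy
    · by_cases hbT : tgt b ∈ T
      · -- the cut loses `a` only, and it was not tight
        have hlt : m < #(outCut src tgt F T) := by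
          refine lt_of_le_of_ne hm fun heq => ?_
          have hT : Tight T := ⟨hsT, htT, haT, heq.symm⟩
          have h1 := card_outCut_inter_add_card_outCut_union src tgt F S T
          have h2 := hcut (S ∩ T) (mem_inter.2 ⟨hS.1, hsT⟩) (fun h => htT (mem_inter.1 h).2)
          have h3 := hcut (S ∪ T) (mem_union_left _ hS.1)
            (fun h => (mem_union.1 h).elim hS.2.1 htT)
          have h4 := hS.2.2.2
          have hST : Tight (S ∪ T) := ⟨mem_union_left _ hS.1,
            fun h => (mem_union.1 h).elim hS.2.1 htT,
            fun h => (mem_union.1 h).elim hS.2.2.1 haT, by omega⟩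
          refine (hmax _ hST).not_gt (card_lt_card ?_)
          refine (ssubset_iff_of_subset fun x hx => ?_).2 ⟨b, ?_, ?_⟩
          · rw [mem_filter] at hx ⊢
            exact ⟨hx.1, mem_union_left _ hx.2⟩
          · rw [mem_filter]
            exact ⟨hbF, mem_union_right _ hbT⟩
          · rw [mem_filter]
            exact fun h => hbt h.2
        have hsub : outCut src tgt F T ⊆
            insert a (outCut src (Function.update tgt a (tgt b)) (F.erase b) T) := by
          intro x hx
          rw [mem_outCut] at hx
          rw [mem_insert, mem_outCut, mem_erase]
          rcases eq_or_ne x a with hxa | hxa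
          · exact Or.inl hxa
          · rw [Function.update_of_ne hxa]
            exact Or.inr ⟨⟨fun h => hx.2.2 (h ▸ hbT), hx.1⟩, hx.2⟩
        have := (card_le_card hsub).trans (card_insert_le _ _)
        omega
      · -- `b` did not cross `T`, and `a` still crosses it
        refine hm.trans (card_le_card fun x hx => ?_)
        rw [mem_outCut] at hx
        rw [mem_outCut, mem_erase]
        refine ⟨⟨?_, hx.1⟩, hx.2.1, ?_⟩
        · rintro rfl
          exact haT (hbs ▸ hx.2.1)
        · rcases eq_or_ne x a with rfl | hxa
          · rwa [Function.update_self]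
          · rw [Function.update_of_ne hxa]
            exact hx.2.2

/-- Menger's theorem for arcs: if every cut separating `t` from `s` has at least `m` arcs of `F`,
then `F` contains `m` pairwise arc-disjoint walks from `s` to `t`. -/
theorem exists_disjoint_walks (G : MultiDigraph V A) {s t : V} (hst : s ≠ t) (m : ℕ)
    (F : Finset A)
    (hcut : ∀ S : Finset V, s ∈ S → t ∉ S → m ≤ #(outCut G.src G.tgt F S)) :
    ∃ q : Fin m → List A, (∀ i, G.IsWalk s (q i) t) ∧ (∀ i, ∀ x ∈ q i, x ∈ F) ∧
      ∀ i j, i ≠ j → List.Disjoint (q i) (q j) := by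
  obtain ⟨D, q, hD, hq, hE, hd⟩ := exists_disjoint_walks_aux G hst m (F : Set A) F G.src G.tgt
    (fun a => [a]) (fun a _ => isWalk_singleton rfl rfl)
    (fun a ha x hx => by rw [List.mem_singleton.1 hx]; exact ha)
    (fun a _ b _ hab => by simpa using hab.symm) hcut
  obtain ⟨g⟩ : Nonempty (Fin m ↪ D) :=
    Function.Embedding.nonempty_of_card_le (by simpa using hD)
  exact ⟨fun i => q (g i), fun i => hq _ (g i).2, fun i => hE _ (g i).2,
    fun i j hij => hd _ (g i).2 _ (g j).2 fun h => hij (g.injective (Subtype.ext h))⟩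

end Cuts

/-! ### Immersions and packings inside a set of arcs -/

section Immersions

variable {V A W B : Type*}

/-- `H` is immersed in the subdigraph of `G` formed by the arcs in `F` (and all vertices). -/
def ImmersesIn (G : MultiDigraph V A) (H : MultiDigraph W B) (F : Finset A) : Prop :=
  ∃ (φ : W → V) (P : B → List A), Function.Injective φ ∧
    (∀ e, G.IsPath (φ (H.src e)) (P e) (φ (H.tgt e))) ∧ (∀ e, ∀ a ∈ P e, a ∈ F) ∧
    ∀ e e', e ≠ e' → List.Disjoint (P e) (P e')

/-- `F` contains `k` pairwise disjoint sets of arcs in each of which `H` is immersed. -/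
def Packs (G : MultiDigraph V A) (H : MultiDigraph W B) (k : ℕ) (F : Finset A) : Prop :=
  ∃ K : Fin k → Finset A, (∀ i j, i ≠ j → Disjoint (K i) (K j)) ∧ (∀ i, K i ⊆ F) ∧
    ∀ i, ImmersesIn G H (K i)

open Classical in
/-- The arcs of `F` with both ends in `S`. -/
noncomputable def inside (G : MultiDigraph V A) (F : Finset A) (S : Finset V) : Finset A :=
  F.filter fun a => G.src a ∈ S ∧ G.tgt a ∈ S

/-- The arcs in `F` form a semicomplete digraph with vertex set `U`. -/
def SemicompleteOn (G : MultiDigraph V A) (F : Finset A) (U : Finset V) : Prop :=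
  (∀ a ∈ F, G.src a ∈ U ∧ G.tgt a ∈ U) ∧ ∀ u ∈ U, ∀ v ∈ U, u ≠ v →
    ∃ a ∈ F, (G.src a = u ∧ G.tgt a = v) ∨ (G.src a = v ∧ G.tgt a = u)

variable {G : MultiDigraph V A} {H : MultiDigraph W B}

theorem mem_inside {F : Finset A} {S : Finset V} {a : A} :
    a ∈ G.inside F S ↔ a ∈ F ∧ G.src a ∈ S ∧ G.tgt a ∈ S := by
  classical
  simp [inside]

theorem SemicompleteOn.inside {F : Finset A} {U S : Finset V} (h : G.SemicompleteOn F U)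
    (hS : S ⊆ U) : G.SemicompleteOn (G.inside F S) S := by
  refine ⟨fun a ha => (mem_inside.1 ha).2, fun u hu v hv huv => ?_⟩
  obtain ⟨a, ha, hj⟩ := h.2 u (hS hu) v (hS hv) huv
  refine ⟨a, mem_inside.2 ⟨ha, ?_⟩, hj⟩
  rcases hj with ⟨rfl, rfl⟩ | ⟨rfl, rfl⟩
  · exact ⟨hu, hv⟩
  · exact ⟨hv, hu⟩

theorem ImmersesIn.mono {F F' : Finset A} (h : ImmersesIn G H F) (hF : F ⊆ F') :
    ImmersesIn G H F' := by
  obtain ⟨φ, P, h1, h2, h3, h4⟩ := h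
  exact ⟨φ, P, h1, h2, fun e a ha => hF (h3 e a ha), h4⟩

theorem Packs.mono {k : ℕ} {F F' : Finset A} (h : Packs G H k F) (hF : F ⊆ F') :
    Packs G H k F' := by
  obtain ⟨K, h1, h2, h3⟩ := h
  exact ⟨K, h1, fun i => (h2 i).trans hF, h3⟩

theorem packs_zero (F : Finset A) : Packs G H 0 F :=
  ⟨fun i => i.elim0, fun i => i.elim0, fun i => i.elim0, fun i => i.elim0⟩

theorem Packs.succ {k : ℕ} {F F₁ F₂ : Finset A} (h₁ : ImmersesIn G H F₁) (h₂ : Packs G H k F₂)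
    (hd : Disjoint F₁ F₂) (hF₁ : F₁ ⊆ F) (hF₂ : F₂ ⊆ F) : Packs G H (k + 1) F := by
  obtain ⟨K, hK1, hK2, hK3⟩ := h₂
  refine ⟨Fin.cons F₁ K, ?_, ?_, ?_⟩
  · intro i j hij
    induction i using Fin.cases with
    | zero =>
      induction j using Fin.cases with
      | zero => exact absurd rfl hij
      | succ j => simpa using hd.mono_right (hK2 j)
    | succ i =>
      induction j using Fin.cases with
      | zero => simpa using (hd.mono_right (hK2 i)).symm
      | succ j => simpa using hK1 i j fun h => hij (congrArg _ h)
  · intro i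
    induction i using Fin.cases with
    | zero => simpa using hF₁
    | succ i => simpa using (hK2 i).trans hF₂
  · intro i
    induction i using Fin.cases with
    | zero => simpa using h₁
    | succ i => simpa using hK3 i

/-- A family of pairwise arc-disjoint walks, one for each arc of each of `k` copies of `H`, gives a
packing. The copies may share their branch vertices, so one map `φ` serves them all. -/
theorem packs_of_walks [Finite B] {k : ℕ} {F : Finset A} (φ : W → V)
    (hφ : Function.Injective φ) (P : Fin k × B → List A)
    (hP : ∀ x, G.IsWalk (φ (H.src x.2)) (P x) (φ (H.tgt x.2)))
    (hF : ∀ x, ∀ a ∈ P x, a ∈ F) (hd : ∀ x y, x ≠ y → List.Disjoint (P x) (P y)) :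
    Packs G H k F := by
  classical
  choose P' hP' hp using fun x => (hP x).exists_isPath
  refine ⟨fun i => F.filter fun a => ∃ e, a ∈ P' (i, e), fun i j hij => ?_,
    fun i => filter_subset _ _, fun i => ⟨φ, fun e => P' (i, e), hφ, fun e => hp (i, e),
      fun e a ha => mem_filter.2 ⟨hF _ a (hP' _ ha), e, ha⟩, fun e e' he a ha ha' =>
        hd (i, e) (i, e') (by simpa using he) (hP' _ ha) (hP' _ ha')⟩⟩
  rw [Finset.disjoint_left]
  intro a ha ha'
  obtain ⟨-, e, ha⟩ := mem_filter.1 ha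
  obtain ⟨-, e', ha'⟩ := mem_filter.1 ha'
  exact hd (i, e) (j, e') (by simp [hij]) (hP' _ ha) (hP' _ ha')

theorem not_immersesIn_empty (hB : Nonempty B) : ¬ ImmersesIn G H ∅ := by
  rintro ⟨φ, P, hφ, hP, hF, -⟩
  obtain ⟨e⟩ := hB
  have h1 := (hP e).1
  cases hl : P e with
  | nil =>
    rw [hl] at h1
    exact H.loopless e (hφ h1)
  | cons a l => simpa using hF e a (by simp [hl])

/-- If every arc needed has at least `k * #B` parallel arcs, then a single immersion can be copied
`k` times: a path uses at most one arc of each parallel class. -/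
theorem packs_of_parallel [Finite B] [Nonempty B] {k : ℕ} {F F' : Finset A} (h : ImmersesIn G H F')
    (hF : ∀ a ∈ F', ∃ D ⊆ F, k * Nat.card B ≤ #D ∧
      ∀ x ∈ D, G.src x = G.src a ∧ G.tgt x = G.tgt a) : Packs G H k F := by
  classical
  obtain ⟨φ, P, hφ, hP, hPF, hPd⟩ := h
  have hA : Nonempty A := by
    by_contra hA
    rw [not_nonempty_iff] at hA
    refine not_immersesIn_empty (G := G) ‹Nonempty B› ⟨φ, P, hφ, hP, ?_, hPd⟩
    exact fun e a => hA.elim a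
  have hpar : ∀ p : V × V, (∃ a ∈ F', G.src a = p.1 ∧ G.tgt a = p.2) →
      ∃ g : Fin k × B → A, Function.Injective g ∧
        ∀ x, g x ∈ F ∧ G.src (g x) = p.1 ∧ G.tgt (g x) = p.2 := by
    rintro ⟨u, v⟩ ⟨a, ha, rfl, rfl⟩
    obtain ⟨D, hD, hc, hp⟩ := hF a ha
    have := Fintype.ofFinite B
    obtain ⟨g⟩ : Nonempty (Fin k × B ↪ D) :=
      Function.Embedding.nonempty_of_card_le (by simpa using hc)
    exact ⟨fun x => g x, fun x y hxy => g.injective (Subtype.ext hxy),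
      fun x => ⟨hD (g x).2, hp _ (g x).2⟩⟩
  choose! g hg using hpar
  have hg' := fun e a (ha : a ∈ P e) => hg (G.src a, G.tgt a) ⟨a, hPF e a ha, rfl, rfl⟩
  refine packs_of_walks φ hφ (fun x => (P x.2).map fun a => g (G.src a, G.tgt a) x)
    (fun x => ((hP x.2).map_parallel _ fun a ha => ((hg' x.2 a ha).2 x).2).1) ?_ ?_
  · intro x b hb
    obtain ⟨a, ha, rfl⟩ := List.mem_map.1 hb
    exact ((hg' x.2 a ha).2 x).1
  · intro x y hxy b hb hb'
    obtain ⟨a, ha, rfl⟩ := List.mem_map.1 hb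
    obtain ⟨a', ha', heq⟩ := List.mem_map.1 hb'
    have h1 := ((hg' x.2 a ha).2 x).2
    have h2 := ((hg' y.2 a' ha').2 y).2
    rw [heq] at h2
    have hp : (G.src a', G.tgt a') = (G.src a, G.tgt a) :=
      Prod.ext (h2.1.symm.trans h1.1) (h2.2.symm.trans h1.2)
    simp only [hp] at heq
    exact hxy ((hg' x.2 a ha).1 heq).symm

theorem StronglyConnected.exists_arc (hH : H.StronglyConnected) (hW : 2 ≤ Nat.card W) :
    Nonempty B := by
  have : Finite W := Nat.finite_of_card_ne_zero (by omega)
  have : Nontrivial W := Finite.one_lt_card_iff_nontrivial.1 hW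
  obtain ⟨u, v, huv⟩ := exists_pair_ne W
  obtain ⟨l, hl⟩ := hH.2 u v
  cases l with
  | nil => exact absurd hl.1 huv
  | cons a l => exact ⟨a⟩

/-- A strongly connected digraph immersed in a set of arcs none of which leaves `S` is immersed on
one side of `S`. -/
theorem ImmersesIn.inside_or_inside [DecidableEq V] (hH : H.StronglyConnected) {F : Finset A}
    {U S : Finset V} (hU : ∀ a ∈ F, G.src a ∈ U ∧ G.tgt a ∈ U)
    (hS : ∀ a ∈ F, G.src a ∈ S → G.tgt a ∈ S) (h : ImmersesIn G H F) :
    ImmersesIn G H (G.inside F S) ∨ ImmersesIn G H (G.inside F (U \ S)) := by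
  obtain ⟨φ, P, hφ, hP, hF, hd⟩ := h
  by_cases hw : ∃ w, φ w ∈ S
  · obtain ⟨w, hw⟩ := hw
    have hwalk : ∀ (u v : W) (l : List B), H.IsWalk u l v → φ u ∈ S → φ v ∈ S := by
      intro u v l hl hu
      induction l generalizing u with
      | nil => cases hl; exact hu
      | cons e l ih =>
        obtain ⟨rfl, hl⟩ := hl
        exact ih _ hl ((hP e).1.mem_of_start_mem (S := (S : Set V))
          (fun a ha => hS a (hF e a ha)) hu).1
    left
    refine ⟨φ, P, hφ, hP, fun e a ha => ?_, hd⟩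
    obtain ⟨l, hl⟩ := hH.2 w (H.src e)
    exact mem_inside.2 ⟨hF e a ha, ((hP e).1.mem_of_start_mem (S := (S : Set V))
      (fun a ha => hS a (hF e a ha)) (hwalk _ _ _ hl.1 hw)).2 a ha⟩
  · right
    push Not at hw
    refine ⟨φ, P, hφ, hP, fun e a ha => ?_, hd⟩
    have := ((hP e).1.notMem_of_end_notMem (S := (S : Set V))
      (fun a ha => hS a (hF e a ha)) (hw _)).2 a ha
    have hUa := hU a (hF e a ha)
    exact mem_inside.2 ⟨hF e a ha, mem_sdiff.2 ⟨hUa.1, this.1⟩, mem_sdiff.2 ⟨hUa.2, this.2⟩⟩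

/-- A walk whose arcs belong to a subdigraph is a walk of the subdigraph. -/
theorem exists_isWalk_toMultiDigraph (K : G.Subdigraph) {u v : V} {l : List A}
    (h : G.IsWalk u l v) (hl : ∀ a ∈ l, a ∈ K.arcs) (hu : u ∈ K.verts) (hv : v ∈ K.verts) :
    ∃ l' : List K.arcs, l'.map Subtype.val = l ∧
      K.toMultiDigraph.IsWalk ⟨u, hu⟩ l' ⟨v, hv⟩ := by
  induction l generalizing u with
  | nil => exact ⟨[], rfl, Subtype.ext h⟩
  | cons a l ih =>
    obtain ⟨l', hl', hw⟩ := ih h.2 (fun b hb => hl b (by simp [hb])) (K.tgt_mem a (hl a (by simp)))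
    exact ⟨⟨a, hl a (by simp)⟩ :: l', by simp [hl'], Subtype.ext h.1, hw⟩

theorem ImmersesIn.containsImmersion {F : Finset A} (h : ImmersesIn G H F) :
    (Subdigraph.mk (G := G) Set.univ (F : Set A) (fun _ _ => trivial)
      (fun _ _ => trivial)).toMultiDigraph.ContainsImmersion H := by
  obtain ⟨φ, P, hφ, hP, hF, hd⟩ := h
  choose P' hP' hw using fun e => exists_isWalk_toMultiDigraph
    (Subdigraph.mk (G := G) Set.univ (F : Set A) (fun _ _ => trivial) (fun _ _ => trivial))
    (hP e).1 (hF e) trivial trivial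
  refine ⟨fun w => ⟨φ w, trivial⟩, P', fun x y hxy => hφ (congrArg Subtype.val hxy),
    fun e => ⟨hw e, ?_⟩, fun e e' he a ha ha' => hd e e' he (a := a.1) ?_ ?_⟩
  · refine List.Nodup.of_map Subtype.val ?_
    have := (hP e).2
    rw [← hP' e, List.map_map] at this
    rw [List.map_cons, List.map_map]
    exact this
  · rw [← hP' e]
    exact List.mem_map_of_mem ha
  · rw [← hP' e']
    exact List.mem_map_of_mem ha'

open Classical in
theorem immersesIn_of_deleteArcs [Fintype A] {X : Finset A}
    (h : (G.deleteArcs (X : Set A)).ContainsImmersion H) :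
    ImmersesIn G H (univ \ X) := by
  obtain ⟨φ, P, hφ, hP, hd⟩ := h
  have hw : ∀ (u v : V) l, (G.deleteArcs (X : Set A)).IsWalk u l v →
      G.IsWalk u (l.map Subtype.val) v := by
    intro u v l hl
    induction l generalizing u with
    | nil => exact hl
    | cons a l ih => exact ⟨hl.1, ih _ hl.2⟩
  refine ⟨φ, fun e => (P e).map Subtype.val, hφ, fun e => ⟨hw _ _ _ (hP e).1, ?_⟩, ?_, ?_⟩
  · have := (hP e).2
    rw [List.map_map]
    exact this
  · intro e a ha
    obtain ⟨b, -, rfl⟩ := List.mem_map.1 ha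
    exact mem_sdiff.2 ⟨mem_univ _, fun h => b.2 (mem_coe.2 h)⟩
  · intro e e' he
    exact List.disjoint_map Subtype.val_injective (hd e e' he)

end Immersions

/-! ### Counting in semicomplete digraphs -/

section Counting

variable {V A W B : Type*}

open Classical in
/-- If any two distinct elements of `Y` are related in some direction and each element is related
to at most `D` others, then `Y` is small. -/
theorem card_le_of_total_of_outdegree_le {Y : Finset V} {r : V → V → Prop} {D : ℕ}
    (htot : ∀ p ∈ Y, ∀ q ∈ Y, p ≠ q → r p q ∨ r q p)
    (hD : ∀ p ∈ Y, ∃ T : Finset V, #T ≤ D ∧ ∀ q ∈ Y, p ≠ q → r p q → q ∈ T) : #Y ≤ 2 * D + 1 := by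
  have h1 : ∑ p ∈ Y, ∑ q ∈ Y, (if p ≠ q then 1 else 0) ≤
      ∑ p ∈ Y, ∑ q ∈ Y, ((if p ≠ q ∧ r p q then 1 else 0) +
        if q ≠ p ∧ r q p then 1 else 0) := by
    refine sum_le_sum fun p hp => sum_le_sum fun q hq => ?_
    by_cases hpq : p = q
    · simp [hpq]
    · rcases htot p hp q hq hpq with h | h <;> simp [hpq, Ne.symm hpq, h]
  have h2 : ∑ p ∈ Y, ∑ q ∈ Y, (if p ≠ q ∧ r p q then 1 else 0) ≤ #Y * D := by
    rw [← smul_eq_mul]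
    refine sum_le_card_nsmul _ _ _ fun p hp => ?_
    rw [← card_filter]
    obtain ⟨T, hT, hpT⟩ := hD p hp
    refine (card_le_card fun q hq => ?_).trans hT
    obtain ⟨hq, hpq, hr⟩ := mem_filter.1 hq
    exact hpT q hq hpq hr
  have h3 : ∑ p ∈ Y, ∑ q ∈ Y, (if p ≠ q then 1 else 0) = #Y * (#Y - 1) := by
    rw [← smul_eq_mul]
    refine sum_const_nat fun p hp => ?_
    rw [← card_filter, filter_ne, card_erase_of_mem hp]
  have h4 : ∑ p ∈ Y, ∑ q ∈ Y, (if q ≠ p ∧ r q p then 1 else 0) =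
      ∑ p ∈ Y, ∑ q ∈ Y, (if p ≠ q ∧ r p q then 1 else 0) := sum_comm
  simp only [sum_add_distrib] at h1
  rw [h3, h4] at h1
  rcases Nat.eq_zero_or_pos #Y with h0 | h0
  · omega
  · have : #Y * (#Y - 1) ≤ #Y * (2 * D) := by
      calc _ ≤ _ := h1
        _ ≤ #Y * D + #Y * D := Nat.add_le_add h2 h2
        _ = _ := by ring
    have := Nat.le_of_mul_le_mul_left this h0
    omega

/-- The lemma of Erdős and Moser: a semicomplete digraph on `2 ^ n` vertices has a transitive
subtournament on `n` vertices. -/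
theorem exists_transitive {r : V → V → Prop} (n : ℕ) {Y : Finset V} (hY : 2 ^ n ≤ #Y)
    (htot : ∀ p ∈ Y, ∀ q ∈ Y, p ≠ q → r p q ∨ r q p) :
    ∃ z : ℕ → V, (∀ i < n, z i ∈ Y) ∧ ∀ i j, i < j → j < n → r (z i) (z j) := by
  classical
  induction n generalizing Y with
  | zero =>
    obtain ⟨v, -⟩ := card_pos.1 (Nat.lt_of_lt_of_le (by simp) hY)
    exact ⟨fun _ => v, by simp, by simp⟩
  | succ n ih =>
    obtain ⟨p, hp, hlt⟩ : ∃ p ∈ Y, 2 ^ n ≤ #(Y.filter fun q => p ≠ q ∧ r p q) := by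
      by_contra! hno
      have hpos : 0 < 2 ^ n := by positivity
      have := card_le_of_total_of_outdegree_le htot (D := 2 ^ n - 1)
        fun p hp => ⟨_, Nat.le_sub_one_of_lt (hno p hp),
          fun q hq hpq hr => mem_filter.2 ⟨hq, hpq, hr⟩⟩
      rw [pow_succ] at hY
      omega
    obtain ⟨z, hz, hr⟩ := ih hlt fun p hp q hq => htot p (mem_filter.1 hp).1 q (mem_filter.1 hq).1
    refine ⟨fun i => Nat.casesOn i p z, ?_, ?_⟩
    · rintro (_ | i) hi
      · exact hp
      · exact (mem_filter.1 (hz i (by omega))).1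
    · rintro (_ | i) (_ | j) hij hj
      · omega
      · exact (mem_filter.1 (hz j (by omega))).2.2
      · omega
      · exact hr i j (by omega) (by omega)

variable {src tgt : A → V} {F : Finset A} {U : Finset V} {c : ℕ}

open Classical in
/-- Cuts in a semicomplete digraph are nearly nested: every pair in `(S \ T) × (T \ S)` is joined by
an arc of one of the two cuts. -/
theorem card_sdiff_mul_card_sdiff_le
    (htot : ∀ u ∈ U, ∀ v ∈ U, u ≠ v →
      ∃ a ∈ F, (src a = u ∧ tgt a = v) ∨ (src a = v ∧ tgt a = u))
    {S T : Finset V} (hS : S ⊆ U) (hT : T ⊆ U) :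
    #(S \ T) * #(T \ S) ≤ #(outCut src tgt F S) + #(outCut src tgt F T) := by
  rw [← card_product]
  have hsub : (S \ T) ×ˢ (T \ S) ⊆ (outCut src tgt F S).image (fun a => (src a, tgt a)) ∪
      (outCut src tgt F T).image (fun a => (tgt a, src a)) := by
    rintro ⟨u, v⟩ huv
    obtain ⟨hu, hv⟩ := mem_product.1 huv
    simp only [mem_sdiff] at hu hv
    have hne : u ≠ v := fun h => hu.2 (h ▸ hv.1)
    obtain ⟨a, ha, ⟨rfl, rfl⟩ | ⟨rfl, rfl⟩⟩ := htot u (hS hu.1) v (hT hv.1) hne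
    · exact mem_union_left _ (mem_image.2 ⟨a, mem_outCut.2 ⟨ha, hu.1, hv.2⟩, rfl⟩)
    · exact mem_union_right _ (mem_image.2 ⟨a, mem_outCut.2 ⟨ha, hv.1, hu.2⟩, rfl⟩)
  exact (card_le_card hsub).trans ((card_union_le _ _).trans
    (Nat.add_le_add card_image_le card_image_le))

open Classical in
/-- In a semicomplete digraph, a largest set of out-boundary at most `c` in a given family covers the
union of the family up to a bounded number of vertices. -/
theorem exists_mem_card_biUnion_sdiff_le
    (htot : ∀ u ∈ U, ∀ v ∈ U, u ≠ v →
      ∃ a ∈ F, (src a = u ∧ tgt a = v) ∨ (src a = v ∧ tgt a = u))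
    {𝓕 : Finset (Finset V)} (hne : 𝓕.Nonempty) (hU : ∀ S ∈ 𝓕, S ⊆ U)
    (hc : ∀ S ∈ 𝓕, #(outCut src tgt F S) ≤ c) :
    ∃ L ∈ 𝓕, #(𝓕.biUnion id \ L) ≤ 6 * c + 1 := by
  obtain ⟨L, hL, hmax⟩ := 𝓕.exists_max_image card hne
  refine ⟨L, hL, ?_⟩
  have hsmall : ∀ T ∈ 𝓕, #(T \ L) ≤ 2 * c := by
    intro T hT
    have h1 := card_sdiff_mul_card_sdiff_le htot (hU T hT) (hU L hL)
    have h2 : #(T \ L) ≤ #(L \ T) := by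
      have := card_sdiff_add_card_inter T L
      have := card_sdiff_add_card_inter L T
      have := hmax T hT
      rw [inter_comm L T] at *
      omega
    have h3 := hc T hT
    have h4 := hc L hL
    have h5 : #(T \ L) ≤ #(T \ L) * #(L \ T) := by
      rcases Nat.eq_zero_or_pos #(T \ L) with h0 | h0
      · omega
      · exact Nat.le_mul_of_pos_right _ (by omega)
    omega
  have hch : ∀ p ∈ 𝓕.biUnion id \ L, ∃ T ∈ 𝓕, p ∈ T := fun p hp => by
    simpa using (mem_sdiff.1 hp).1
  choose! T hT hpT using hch
  have hYU : ∀ p ∈ 𝓕.biUnion id \ L, p ∈ U := fun p hp => hU _ (hT p hp) (hpT p hp)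
  have key := card_le_of_total_of_outdegree_le (Y := 𝓕.biUnion id \ L) (D := 3 * c)
    (r := fun p q => ∃ a ∈ F, src a = p ∧ tgt a = q) ?_ ?_
  · omega
  · intro p hp q hq hpq
    obtain ⟨a, ha, h | h⟩ := htot p (hYU p hp) q (hYU q hq) hpq
    · exact Or.inl ⟨a, ha, h⟩
    · exact Or.inr ⟨a, ha, h⟩
  · intro p hp
    have h2 : #((outCut src tgt F (T p)).image tgt) ≤ c := card_image_le.trans (hc _ (hT p hp))
    have h3 := hsmall _ (hT p hp)
    have h1 := card_union_le (T p \ L) ((outCut src tgt F (T p)).image tgt)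
    refine ⟨_, h1.trans (by omega), ?_⟩
    rintro q hq - ⟨a, ha, hs, rfl⟩
    by_cases hqT : tgt a ∈ T p
    · exact mem_union_left _ (mem_sdiff.2 ⟨hqT, (mem_sdiff.1 hq).2⟩)
    · exact mem_union_right _ (mem_image.2
        ⟨a, mem_outCut.2 ⟨ha, hs ▸ hpT p hp, hqT⟩, rfl⟩)

end Counting

/-! ### Transitive subtournaments with many return walks -/

section Transitive

variable {V A W B : Type*} {G : MultiDigraph V A} {H : MultiDigraph W B}

/-- A transitive subtournament together with enough walks from its last vertex back to its first
one yields `k` copies of `H`. Vertex `0` is the start, the next `M` vertices are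
the distributors `d`, then come the `m` branch vertices, then `M` collectors `c`, then the end. An arc
from `x` to `y` is realized as `x → c → end ⇝ start → d → y`, with its own `c`, `d` and return
walk. -/
theorem packs_of_transitive [Fintype W] [Fintype B] {k M m : ℕ}
    (hM : k * Fintype.card B = M) (hm : Fintype.card W = m) {F Z : Finset A} {z : ℕ → V}
    (g : ℕ → ℕ → A)
    (hg : ∀ i j, i < j → j < 2 * M + m + 2 →
      g i j ∈ F ∧ g i j ∈ Z ∧ G.src (g i j) = z i ∧ G.tgt (g i j) = z j)
    (q : Fin M → List A)
    (hq : ∀ i, G.IsWalk (z (2 * M + m + 1)) (q i) (z 0))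
    (hqF : ∀ i, ∀ a ∈ q i, a ∈ F ∧ a ∉ Z)
    (hqd : ∀ i j, i ≠ j → List.Disjoint (q i) (q j)) : Packs G H k F := by
  classical
  have hinj : ∀ i j, i < 2 * M + m + 2 → j < 2 * M + m + 2 → z i = z j → i = j := by
    intro i j hi hj h
    rcases lt_trichotomy i j with hij | hij | hij
    · have := hg i j hij hj
      exact absurd (this.2.2.1.trans (h.trans this.2.2.2.symm)) (G.loopless _)
    · exact hij
    · have := hg j i hij hi
      exact absurd (this.2.2.1.trans (h.symm.trans this.2.2.2.symm)) (G.loopless _)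
  have hginj : ∀ i j i' j', i < j → j < 2 * M + m + 2 → i' < j' → j' < 2 * M + m + 2 →
      g i j = g i' j' → i = i' ∧ j = j' := by
    intro i j i' j' hij hj hij' hj' h
    have h1 := (hg i j hij hj).2.2
    have h2 := (hg i' j' hij' hj').2.2
    rw [h] at h1
    exact ⟨hinj i i' (by omega) (by omega) (h1.1.symm.trans h2.1),
      hinj j j' hj hj' (h1.2.symm.trans h2.2)⟩
  let e : Fin k × B ≃ Fin M := Fintype.equivFinOfCardEq (by simp [hM])
  let o : W ≃ Fin m := Fintype.equivFinOfCardEq hm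
  let br : W → ℕ := fun w => 1 + M + o w
  have hbr : ∀ w, 1 + M ≤ br w ∧ br w < 1 + M + m := fun w => by
    have := (o w).2
    simp only [br]
    omega
  let P : Fin k × B → List A := fun x =>
    [g (br (H.src x.2)) (1 + M + m + e x), g (1 + M + m + e x) (2 * M + m + 1)] ++ (q (e x) ++
      [g 0 (1 + e x), g (1 + e x) (br (H.tgt x.2))])
  have hP : ∀ x, ∀ a ∈ P x, a ∈ q (e x) ∨ ∃ i j, i < j ∧ j < 2 * M + m + 2 ∧ a = g i j ∧
      ((i < 1 + M + m ∧ j = 1 + M + m + e x ∨ i = 1 + M + m + e x) ∨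
        (i = 0 ∧ j = 1 + e x ∨ i = 1 + e x ∧ j < 1 + M + m)) := by
    intro x a ha
    have h1 := hbr (H.src x.2)
    have h2 := hbr (H.tgt x.2)
    have h3 := (e x).2
    simp only [P, List.mem_append, List.mem_cons, List.not_mem_nil, or_false] at ha
    rcases ha with (rfl | rfl) | ha | rfl | rfl
    · exact Or.inr ⟨_, _, by omega, by omega, rfl, by omega⟩
    · exact Or.inr ⟨_, _, by omega, by omega, rfl, by omega⟩
    · exact Or.inl ha
    · exact Or.inr ⟨_, _, by omega, by omega, rfl, by omega⟩
    · exact Or.inr ⟨_, _, by omega, by omega, rfl, by omega⟩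
  refine packs_of_walks (fun w => z (br w)) ?_ P ?_ ?_ ?_
  · intro w w' h
    have h1 := hbr w
    have h2 := hbr w'
    have := hinj _ _ (by omega) (by omega) h
    simp only [br] at this
    exact o.injective (Fin.ext (by omega))
  · intro x
    have h1 := hbr (H.src x.2)
    have h2 := hbr (H.tgt x.2)
    have h3 := (e x).2
    have g1 := (hg (br (H.src x.2)) (1 + M + m + e x) (by omega) (by omega)).2.2
    have g2 := (hg (1 + M + m + e x) (2 * M + m + 1) (by omega) (by omega)).2.2
    have g3 := (hg 0 (1 + e x) (by omega) (by omega)).2.2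
    have g4 := (hg (1 + e x) (br (H.tgt x.2)) (by omega) (by omega)).2.2
    refine IsWalk.append (v := z (2 * M + m + 1)) ⟨g1.1, g2.1.trans g1.2.symm, g2.2⟩
      (IsWalk.append (hq _) ⟨g3.1, g4.1.trans g3.2.symm, g4.2⟩)
  · intro x a ha
    rcases hP x a ha with h | ⟨i, j, hij, hj, rfl, -⟩
    · exact (hqF _ a h).1
    · exact (hg i j hij hj).1
  · intro x y hxy a ha ha'
    have hexy : e x ≠ e y := fun h => hxy (e.injective h)
    rcases hP x a ha with h | ⟨i, j, hij, hj, h1, hc⟩ <;>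
      rcases hP y a ha' with h' | ⟨i', j', hij', hj', h1', hc'⟩
    · exact hqd _ _ hexy h h'
    · exact (hqF _ a h).2 (h1' ▸ (hg i' j' hij' hj').2.1)
    · exact (hqF _ a h').2 (h1 ▸ (hg i j hij hj).2.1)
    · obtain ⟨rfl, rfl⟩ := hginj _ _ _ _ hij hj hij' hj' (h1.symm.trans h1')
      have h3 := (e x).2
      have h4 := (e y).2
      exact hexy (Fin.ext (by omega))

end Transitive

/-! ### The Erdős–Pósa property -/

section ErdosPosa

variable {V A W B : Type*} {G : MultiDigraph V A} {H : MultiDigraph W B}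

/-- Without `k` copies of `H`, a large set of vertices in a semicomplete digraph contains two that a
small cut separates. -/
theorem exists_outCut_card_le [Fintype W] [Fintype B] {k M m : ℕ}
    (hM : k * Fintype.card B = M) (hm : Fintype.card W = m) {F : Finset A} {U Q : Finset V}
    (hF : G.SemicompleteOn F U) (hp : ¬ Packs G H k F) (hQU : Q ⊆ U)
    (hQ : 2 ^ (2 * M + m + 2) ≤ #Q) :
    ∃ S ⊆ U, ∃ u ∈ Q, ∃ v ∈ Q, u ∈ S ∧ v ∉ S ∧
      #(outCut G.src G.tgt F S) ≤ (2 * M + m + 2) ^ 2 + M := by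
  classical
  set n := 2 * M + m + 2 with hn
  obtain ⟨z, hz, hr⟩ := exists_transitive (r := fun p q => ∃ a ∈ F, G.src a = p ∧ G.tgt a = q)
    n hQ fun p hp q hq hpq => by
      obtain ⟨a, ha, h | h⟩ := hF.2 p (hQU hp) q (hQU hq) hpq
      · exact Or.inl ⟨a, ha, h⟩
      · exact Or.inr ⟨a, ha, h⟩
  have : Nonempty A := ⟨(hr 0 1 (by omega) (by omega)).choose⟩
  choose! g hgF hgs hgt using hr
  let Z : Finset A := (range n ×ˢ range n).image fun p => g p.1 p.2
  have hZ : #Z ≤ n ^ 2 := card_image_le.trans (by simp [sq])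
  have hne : z (2 * M + m + 1) ≠ z 0 := by
    rw [← hgs 0 (2 * M + m + 1) (by omega) (by omega),
      ← hgt 0 (2 * M + m + 1) (by omega) (by omega)]
    exact (G.loopless _).symm
  have hno : ¬ ∀ S : Finset V, z (2 * M + m + 1) ∈ S → z 0 ∉ S →
      M ≤ #(outCut G.src G.tgt (F \ Z) S) := by
    intro hcut
    obtain ⟨q, hq1, hq2, hq3⟩ := exists_disjoint_walks G hne M (F \ Z) hcut
    refine hp (packs_of_transitive hM hm (F := F) (Z := Z) (z := z) g (fun i j hij hj => ?_) q hq1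
      (fun i a ha => mem_sdiff.1 (hq2 i a ha)) hq3)
    exact ⟨hgF i j hij hj, mem_image.2 ⟨(i, j), by simp; omega, rfl⟩, hgs i j hij hj,
      hgt i j hij hj⟩
  push Not at hno
  obtain ⟨S, hsS, htS, hS⟩ := hno
  refine ⟨S ∩ U, inter_subset_right, _, hz (2 * M + m + 1) (by omega), _, hz 0 (by omega),
    mem_inter.2 ⟨hsS, hQU (hz _ (by omega))⟩, fun h => htS (mem_inter.1 h).1, ?_⟩
  have hsub : outCut G.src G.tgt F (S ∩ U) ⊆ outCut G.src G.tgt (F \ Z) S ∪ Z := by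
    intro a ha
    rw [mem_outCut, mem_inter, mem_inter] at ha
    rw [mem_union, mem_outCut, mem_sdiff]
    have := (hF.1 a ha.1).2
    tauto
  have := (card_le_card hsub).trans (card_union_le _ _)
  omega

open Classical in
theorem SemicompleteOn.hitting_of_both_sides (hH : H.StronglyConnected) {F : Finset A}
    {U S : Finset V} (hF : G.SemicompleteOn F U) {X₁ X₂ : Finset A}
    (h₁ : ¬ ImmersesIn G H (G.inside F S \ X₁))
    (h₂ : ¬ ImmersesIn G H (G.inside F (U \ S) \ X₂)) :
    ¬ ImmersesIn G H (F \ (X₁ ∪ X₂ ∪ outCut G.src G.tgt F S)) := by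
  intro h
  have hS : ∀ a ∈ F \ (X₁ ∪ X₂ ∪ outCut G.src G.tgt F S), G.src a ∈ S → G.tgt a ∈ S := by
    intro a ha hs
    by_contra ht
    simp only [mem_sdiff, mem_union, mem_outCut] at ha
    tauto
  rcases h.inside_or_inside hH (fun a ha => hF.1 a (mem_sdiff.1 ha).1) hS with h | h
  · refine h₁ (h.mono fun a ha => ?_)
    simp only [mem_inside, mem_sdiff, mem_union] at ha ⊢
    tauto
  · refine h₂ (h.mono fun a ha => ?_)
    simp only [mem_inside, mem_sdiff, mem_union] at ha ⊢
    tauto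

open Classical in
/-- The case in which every small cut has a side without `H`: after deleting two cuts only boundedly
many vertices matter, and there it suffices to delete the arcs of small multiplicity. -/
theorem exists_hitting_of_sides [Fintype W] [Fintype B] (hH : H.StronglyConnected)
    (hB : Nonempty B) {k M m n c N : ℕ} (hM : k * Fintype.card B = M)
    (hm : Fintype.card W = m) (hn : 2 * M + m + 2 = n) (hc : n ^ 2 + M = c)
    (hN : 2 * (6 * c + 1) + 2 ^ n = N) {F : Finset A} {U : Finset V}
    (hF : G.SemicompleteOn F U) (hp : ¬ Packs G H k F)
    (hside : ∀ S ⊆ U, #(outCut G.src G.tgt F S) ≤ c →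
      ¬ ImmersesIn G H (G.inside F S) ∨ ¬ ImmersesIn G H (G.inside F (U \ S))) :
    ∃ X : Finset A, #X ≤ 2 * c + N ^ 2 * M ∧ ¬ ImmersesIn G H (F \ X) := by
  -- sets without `H` that few arcs leave, and sets without `H` that few arcs enter
  let 𝓛 := U.powerset.filter fun S =>
    #(outCut G.src G.tgt F S) ≤ c ∧ ¬ ImmersesIn G H (G.inside F S)
  let 𝓡 := U.powerset.filter fun S =>
    #(outCut G.tgt G.src F S) ≤ c ∧ ¬ ImmersesIn G H (G.inside F S)
  have hempty : ¬ ImmersesIn G H (G.inside F ∅) := by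
    have : G.inside F ∅ = ∅ := by ext a; simp [mem_inside]
    rw [this]
    exact not_immersesIn_empty hB
  have hcutempty : ∀ src tgt : A → V, #(outCut src tgt F ∅) ≤ c := fun src tgt => by
    simp [outCut]
  have mem𝓛 : ∀ S, S ∈ 𝓛 ↔ S ⊆ U ∧ #(outCut G.src G.tgt F S) ≤ c ∧
      ¬ ImmersesIn G H (G.inside F S) := fun S => by simp [𝓛]
  have mem𝓡 : ∀ S, S ∈ 𝓡 ↔ S ⊆ U ∧ #(outCut G.tgt G.src F S) ≤ c ∧
      ¬ ImmersesIn G H (G.inside F S) := fun S => by simp [𝓡]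
  obtain ⟨L, hL, hYL⟩ := exists_mem_card_biUnion_sdiff_le (c := c) hF.2 (𝓕 := 𝓛)
    ⟨∅, (mem𝓛 _).2 ⟨empty_subset _, hcutempty _ _, hempty⟩⟩
    (fun S hS => ((mem𝓛 S).1 hS).1) (fun S hS => ((mem𝓛 S).1 hS).2.1)
  obtain ⟨R, hR, hYR⟩ := exists_mem_card_biUnion_sdiff_le (c := c) (src := G.tgt) (tgt := G.src)
    (F := F) (U := U)
    (fun u hu v hv huv => by
      obtain ⟨a, ha, h⟩ := hF.2 u hu v hv huv
      exact ⟨a, ha, h.symm.imp And.symm And.symm⟩) (𝓕 := 𝓡)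
    ⟨∅, (mem𝓡 _).2 ⟨empty_subset _, hcutempty _ _, hempty⟩⟩
    (fun S hS => ((mem𝓡 S).1 hS).1) (fun S hS => ((mem𝓡 S).1 hS).2.1)
  -- the vertices in none of these sets cannot be separated from each other
  let Q := U \ (𝓛.biUnion id ∪ 𝓡.biUnion id)
  have hQ : #Q < 2 ^ n := by
    by_contra! hQ
    obtain ⟨S, hSU, u, hu, v, hv, huS, hvS, hS⟩ := exists_outCut_card_le hM hm hF hp
      (Q := Q) sdiff_subset (by rwa [hn])
    rw [hn, hc] at hS
    simp only [Q, mem_sdiff, mem_union, not_or, mem_biUnion, id] at hu hv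
    rcases hside S hSU hS with h | h
    · exact hu.2.1 ⟨S, (mem𝓛 S).2 ⟨hSU, hS, h⟩, huS⟩
    · refine hv.2.2 ⟨U \ S, (mem𝓡 _).2 ⟨sdiff_subset, ?_, h⟩, mem_sdiff.2 ⟨hv.1, hvS⟩⟩
      refine (card_le_card fun a ha => ?_).trans hS
      rw [mem_outCut, mem_sdiff, mem_sdiff] at ha
      rw [mem_outCut]
      have := hF.1 a ha.1
      tauto
  let P := (U \ L) \ R
  have hP : #P ≤ N := by
    have hsub : P ⊆ (𝓛.biUnion id \ L) ∪ (𝓡.biUnion id \ R) ∪ Q := by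
      intro v hv
      simp only [P, Q, mem_sdiff, mem_union] at hv ⊢
      tauto
    have h1 := card_le_card hsub
    have h2 := card_union_le ((𝓛.biUnion id \ L) ∪ (𝓡.biUnion id \ R)) Q
    have h3 := card_union_le (𝓛.biUnion id \ L) (𝓡.biUnion id \ R)
    omega
  -- the arcs in `P` of multiplicity at most `M`
  let cls : V × V → Finset A := fun p => F.filter fun a => G.src a = p.1 ∧ G.tgt a = p.2
  let X₀ := ((P ×ˢ P).filter fun p => #(cls p) ≤ M).biUnion cls
  have hX₀ : #X₀ ≤ N ^ 2 * M := by
    refine (card_biUnion_le_card_mul _ _ M fun p hp => (mem_filter.1 hp).2).trans ?_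
    refine Nat.mul_le_mul_right _ ((card_filter_le _ _).trans ?_)
    rw [card_product, sq]
    exact Nat.mul_le_mul hP hP
  have hPX : ¬ ImmersesIn G H (G.inside F P \ X₀) := by
    intro h
    refine hp (packs_of_parallel h fun a ha => ?_)
    obtain ⟨ha, haX⟩ := mem_sdiff.1 ha
    rw [mem_inside] at ha
    refine ⟨cls (G.src a, G.tgt a), filter_subset _ _, ?_, fun x hx => (mem_filter.1 hx).2⟩
    rw [Nat.card_eq_fintype_card, hM]
    by_contra hlt
    exact haX (mem_biUnion.2 ⟨(G.src a, G.tgt a),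
      mem_filter.2 ⟨mem_product.2 ha.2, (not_le.1 hlt).le⟩, mem_filter.2 ⟨ha.1, rfl, rfl⟩⟩)
  -- outside `L`, the set `P` is obtained by cutting along the complement of `R`
  have hcutR : #(outCut G.src G.tgt (G.inside F (U \ L)) P) ≤ c := by
    refine (card_le_card fun a ha => ?_).trans ((mem𝓡 R).1 hR).2.1
    simp only [mem_outCut, mem_inside, P, mem_sdiff] at ha ⊢
    tauto
  have hR' : ¬ ImmersesIn G H (G.inside (G.inside F (U \ L)) ((U \ L) \ P) \ ∅) := by
    refine fun h => ((mem𝓡 R).1 hR).2.2 (h.mono fun a ha => ?_)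
    simp only [mem_inside, P, mem_sdiff] at ha ⊢
    tauto
  have hP' : ¬ ImmersesIn G H (G.inside (G.inside F (U \ L)) P \ X₀) := by
    refine fun h => hPX (h.mono fun a ha => ?_)
    simp only [mem_inside, mem_sdiff] at ha ⊢
    tauto
  have h1 := (hF.inside (S := U \ L) sdiff_subset).hitting_of_both_sides hH hP' hR'
  have hL' : ¬ ImmersesIn G H (G.inside F L \ ∅) := by
    rw [sdiff_empty]
    exact ((mem𝓛 L).1 hL).2.2
  refine ⟨_, ?_, hF.hitting_of_both_sides hH hL' h1⟩
  have h2 := ((mem𝓛 L).1 hL).2.1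
  rw [empty_union, union_empty]
  have h3 := card_union_le (X₀ ∪ outCut G.src G.tgt (G.inside F (U \ L)) P)
    (outCut G.src G.tgt F L)
  have h4 := card_union_le X₀ (outCut G.src G.tgt (G.inside F (U \ L)) P)
  omega

/-- The Erdős–Pósa property for the subdigraphs of `G` formed by semicomplete sets of arcs, by
induction on `k`. The bound depends on `H` and `k` only. -/
theorem exists_hitting_bound [Fintype W] [Fintype B] (hH : H.StronglyConnected)
    (hB : Nonempty B) (k : ℕ) : ∃ b : ℕ, ∀ (V : Type*) (A : Type*) (G : MultiDigraph V A)
      (F : Finset A) (U : Finset V), G.SemicompleteOn F U → ¬ Packs G H k F →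
        ∃ X : Finset A, #X ≤ b ∧ ∀ F' ⊆ F, Disjoint F' X → ¬ ImmersesIn G H F' := by
  classical
  induction k with
  | zero => exact ⟨0, fun V A G F U _ h => absurd (packs_zero F) h⟩
  | succ k ih =>
    obtain ⟨b, ih⟩ := ih
    obtain ⟨M, hM⟩ : ∃ M, (k + 1) * Fintype.card B = M := ⟨_, rfl⟩
    obtain ⟨m, hm⟩ : ∃ m, Fintype.card W = m := ⟨_, rfl⟩
    obtain ⟨n, hn⟩ : ∃ n, 2 * M + m + 2 = n := ⟨_, rfl⟩
    obtain ⟨c, hc⟩ : ∃ c, n ^ 2 + M = c := ⟨_, rfl⟩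
    obtain ⟨N, hN⟩ : ∃ N, 2 * (6 * c + 1) + 2 ^ n = N := ⟨_, rfl⟩
    refine ⟨2 * b + 2 * c + N ^ 2 * M, fun V A G F U hF hp => ?_⟩
    suffices h : ∃ X : Finset A, #X ≤ 2 * b + 2 * c + N ^ 2 * M ∧ ¬ ImmersesIn G H (F \ X) by
      obtain ⟨X, hX, hX'⟩ := h
      exact ⟨X, hX, fun F' hF' hd h => hX' (h.mono (subset_sdiff.2 ⟨hF', hd⟩))⟩
    by_cases hside : ∀ S ⊆ U, #(outCut G.src G.tgt F S) ≤ c →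
      ¬ ImmersesIn G H (G.inside F S) ∨ ¬ ImmersesIn G H (G.inside F (U \ S))
    · obtain ⟨X, hX, hX'⟩ := exists_hitting_of_sides hH hB hM hm hn hc hN hF hp hside
      exact ⟨X, by omega, hX'⟩
    · push Not at hside
      obtain ⟨S, hSU, hS, h1, h2⟩ := hside
      have hdisj : Disjoint (G.inside F S) (G.inside F (U \ S)) := by
        rw [Finset.disjoint_left]
        intro a ha ha'
        exact (mem_sdiff.1 (mem_inside.1 ha').2.1).2 (mem_inside.1 ha).2.1
      have hsub : ∀ T, G.inside F T ⊆ F := fun T a ha => (mem_inside.1 ha).1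
      obtain ⟨X₁, hX₁, h1'⟩ := ih V A G (G.inside F S) S (hF.inside hSU)
        fun h => hp (Packs.succ h2 h hdisj.symm (hsub _) (hsub _))
      obtain ⟨X₂, hX₂, h2'⟩ := ih V A G (G.inside F (U \ S)) (U \ S) (hF.inside sdiff_subset)
        fun h => hp (Packs.succ h1 h hdisj (hsub _) (hsub _))
      refine ⟨_, ?_, hF.hitting_of_both_sides hH (h1' _ sdiff_subset sdiff_disjoint)
        (h2' _ sdiff_subset sdiff_disjoint)⟩
      have h3 := card_union_le (X₁ ∪ X₂) (outCut G.src G.tgt F S)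
      have h4 := card_union_le X₁ X₂
      omega

end ErdosPosa

end MultiDigraph

open MultiDigraph in
theorem theorem3 {W B : Type*} [Finite W] [Finite B] (H : MultiDigraph W B)
    (hH : H.StronglyConnected) (hW : 2 ≤ Nat.card W) :
    ∃ f : ℕ → ℕ, ∀ (V A : Type*) [Finite V] [Finite A] (G : MultiDigraph V A),
      G.Semicomplete → ∀ k : ℕ, 1 ≤ k →
        (∃ K : Fin k → G.Subdigraph,
          (∀ i j, i ≠ j → Disjoint (K i).arcs (K j).arcs) ∧
          ∀ i, (K i).toMultiDigraph.ContainsImmersion H) ∨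
        ∃ X : Finset A, X.card ≤ f k ∧
          ¬ (G.deleteArcs (X : Set A)).ContainsImmersion H := by
  classical
  have := Fintype.ofFinite W
  have := Fintype.ofFinite B
  choose f hf using exists_hitting_bound hH (hH.exists_arc hW)
  refine ⟨f, fun V A _ _ G hG k _ => ?_⟩
  have := Fintype.ofFinite V
  have := Fintype.ofFinite A
  by_cases hp : Packs G H k Finset.univ
  · obtain ⟨K, hd, -, hK⟩ := hp
    exact Or.inl ⟨_, fun i j hij => Finset.disjoint_coe.2 (hd i j hij),
      fun i => (hK i).containsImmersion⟩
  · obtain ⟨X, hX, hX'⟩ := hf k V A G Finset.univ Finset.univ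
      ⟨fun a _ => by simp, fun u _ v _ huv => by simpa using hG u v huv⟩ hp
    exact Or.inr ⟨X, hX, fun h => hX' _ Finset.sdiff_subset Finset.sdiff_disjoint
      (immersesIn_of_deleteArcs h)⟩
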